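/- Let $\mathbb{YF}$ be the set of all finite words (including the empty word) over the alphabet $\{1,2\}$, ordered as follows: $x\le y$ if, after the longest common suffix of $x$ and $y$ is deleted from both, the number of digits $2$ remaining in $y$ is at least the number of digits remaining in $x$. Let $\mathbf{YF}^*=\langle \mathbb{YF},\ge,2\rangle$ be the first-order structure with the binary relation $\ge$ and a constant naming the one-letter word $2$. Below, "definable" means definable in $\mathbf{YF}^*$ by a first-order formula without parameters, and $1^n$ is the word consisting of $n$ ones, $n\ge 0$. 1. The relation $\{(1^n,1^m,1^l): n,m,l\ge 0,\ n=m+l\}\subseteq\mathbb{YF}^3$ is definable. 2. The relation $\{(1^n,1^m,1^l): n,m,l\ge 0,\ nm=l\}\subseteq\mathbb{YF}^3$ is definable. 3. For $n\ge m\ge 0$ let $R_{n,m}$ be the set of words $w$ that contain at most $m$ twos and are such that every $v\le w$ has a maximal prefix of ones of length at most $n$, and put $s_{n,m}=1^n21^{n-1}2\cdots 1^{n-m+1}21^{n-m}$. Then $s_{n,m}$ is the unique word of maximal length in $R_{n,m}$, its length is $n+mn-\frac{m^2-m}{2}$, and the relation $\{(1^n,1^m,s_{n,m}): n\ge m\ge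 0\}\subseteq\mathbb{YF}^3$ is definable. 4. For every $u\in\mathbb{YF}$ the set $\{u\}$ is definable, and the map $n\mapsto 1^n$ is an interpretation of $\langle\mathbb{N}_0,+,\times\rangle$ in $\mathbf{YF}^*$: it is injective, its image is definable, and the images of the graphs of addition and of multiplication are definable. -/

import Mathlib

namespace YoungFibonacci

/-- The two digits of the alphabet. -/
inductive Digit : Type
  | one : Digit
  | two : Digit

/-- Vertices of the Young–Fibonacci graph: finite words (the empty one included) over the
alphabet of two digits. The head of the list is the leftmost digit. -/
abbrev YF : Type := List Digit

/-- The number of digits `2` in a word. -/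
def twos : YF → ℕ
  | [] => 0
  | Digit.one :: w => twos w
  | Digit.two :: w => twos w + 1

/-- The length of the maximal prefix of a word that consists of digits `1`. -/
def leadingOnes : YF → ℕ
  | Digit.one :: w => leadingOnes w + 1
  | _ => 0

/-- The word `1ⁿ`. -/
def ones (n : ℕ) : YF := List.replicate n Digit.one

/-- `s` is the longest common suffix of `x` and `y`. -/
def IsLongestCommonSuffix (s x y : YF) : Prop :=
  s <:+ x ∧ s <:+ y ∧ ∀ t : YF, t <:+ x → t <:+ y → t.length ≤ s.length

/-- The Young–Fibonacci order `x ≤ y`: after deletion of the longest common suffix, `y` retains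
at least as many digits `2` as `x` retains digits. -/
def le (x y : YF) : Prop :=
  ∃ x' y' s : YF, x = x' ++ s ∧ y = y' ++ s ∧ IsLongestCommonSuffix s x y ∧
    x'.length ≤ twos y'

/-- Function symbols of the language of `YF*`: one constant symbol. -/
inductive StarFunctions : ℕ → Type
  | two : StarFunctions 0

/-- Relation symbols of the language of `YF*`: one binary relation symbol. -/
inductive StarRelations : ℕ → Type
  | ge : StarRelations 2

/-- The first-order language of `YF*`. -/
def starLanguage : FirstOrder.Language where
  Functions := StarFunctions
  Relations := StarRelations

/-- The structure `YF* = ⟨YF, ≥, 2⟩`. -/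
instance starStructure : starLanguage.Structure YF where
  funMap := fun {_} f _ => match f with
    | StarFunctions.two => [Digit.two]
  RelMap := fun {_} r => match r with
    | StarRelations.ge => fun v => le (v 1) (v 0)

/-- Function symbols of the language of arithmetic: two binary operations. -/
inductive ArithFunctions : ℕ → Type
  | add : ArithFunctions 2
  | mul : ArithFunctions 2

/-- The first-order language with two binary function symbols and no relation symbol. -/
def arithLanguage : FirstOrder.Language where
  Functions := ArithFunctions
  Relations := fun _ => Empty

/-- The structure `⟨ℕ, +, ×⟩`. -/
instance arithStructure : arithLanguage.Structure ℕ where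
  funMap := fun {_} f => match f with
    | ArithFunctions.add => fun v => v 0 + v 1
    | ArithFunctions.mul => fun v => v 0 * v 1
  RelMap := fun {_} r => r.elim

/-- The map `f : N → M` is a (one-dimensional, parameter-free) interpretation of the
`L'`-structure `N` in the `L`-structure `M` in which equality is interpreted by equality:
`f` is injective, its range is definable, and the images under `f` of all basic relations and
of the graphs of all basic operations of `N` are definable in `M`. -/
structure IsInterpretation (L' L : FirstOrder.Language) {N M : Type*}
    [L'.Structure N] [L.Structure M] (f : N → M) : Prop where
  injective : Function.Injective f
  range_definable : (∅ : Set M).Definable₁ L (Set.range f)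
  rel_definable : ∀ (k : ℕ) (R : L'.Relations k), (∅ : Set M).Definable L
    {v : Fin k → M | ∃ a : Fin k → N, v = f ∘ a ∧ FirstOrder.Language.Structure.RelMap R a}
  fun_definable : ∀ (k : ℕ) (F : L'.Functions k), (∅ : Set M).Definable L
    {v : Fin (k + 1) → M | ∃ a : Fin k → N,
      v = Fin.snoc (α := fun _ => M) (f ∘ a) (f (FirstOrder.Language.Structure.funMap F a))}

/-- The set `R n m` of the words with at most `m` digits `2` such that every word below
(or equal to) them has its maximal prefix of `1`s of length at most `n`. -/
def boundedWords (n m : ℕ) : Set YF :=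
  {w | twos w ≤ m ∧ ∀ v : YF, le v w → leadingOnes v ≤ n}

/-- The word `1ⁿ 2 1ⁿ⁻¹ 2 ⋯ 1ⁿ⁻ᵐ⁺¹ 2 1ⁿ⁻ᵐ`, used only for `m ≤ n`. -/
def staircase (n m : ℕ) : YF :=
  ((List.range m).flatMap fun i => ones (n - i) ++ [Digit.two]) ++ ones (n - m)

end YoungFibonacci

namespace YoungFibonacci

open FirstOrder Language

/-! ### The combinatorics of the order -/

/-! The order is governed by two rules: equal last digits cancel (`le_append_same`), and if the last
digits differ, then x ≤ y exactly when the length of x is at most the number of twos in y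
(`le_append_ne`).

Prepending 1 to x adds a single element to the principal ideal, and among words beginning with 2,
lying above 1x and lying above 2x are the same. This defines both prepending operations
(`eq_one_cons_iff`, `eq_two_cons_iff`), hence every single word and the words 1^n s for given s.

Counting rests on matching 1^(n+1) with 1^n 2 (`eq_succ_iff_exists_le`): a word is above both
exactly when it has at least n+1 twos (`succ_le_twos_iff`). Since x has length at most n iff it is
below every word with at least n twos, lengths become definable too. Addition is then read off 2^m
1^l, with m twos and length m+l; the words 2^m s are defined as joins (`replicate_two_append_le`).

A bound on leading ones of all words below w is a bound on twos x + leadingOnes s over all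
splittings w = xs, and the staircase is its longest solution. For m = n its length is (n²+3n)/2, a
definable quadratic function, so addition and polarization give multiplication. -/

lemma twos_append (x y : YF) : twos (x ++ y) = twos x + twos y := by
  induction x with
  | nil => simp [twos]
  | cons a x ih => cases a <;> simp [twos, ih]; omega

lemma twos_le_length (x : YF) : twos x ≤ x.length := by
  induction x with
  | nil => simp [twos]
  | cons a x ih => cases a <;> simp [twos] <;> omega

lemma eq_replicate_two_of_length_le {x : YF} (h : x.length ≤ twos x) :
    x = List.replicate x.length Digit.two := by
  induction x with
  | nil => rfl
  | cons a x ih =>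
    have := twos_le_length x
    cases a
    · simp [twos] at h; omega
    · simp [twos] at h
      simpa [List.replicate_succ] using ih h

@[simp] lemma twos_ones (n : ℕ) : twos (ones n) = 0 := by
  induction n with
  | zero => rfl
  | succ n ih => simpa [ones, List.replicate_succ, twos] using ih

@[simp] lemma twos_replicate_two (n : ℕ) : twos (List.replicate n Digit.two) = n := by
  induction n with
  | zero => rfl
  | succ n ih => simpa [List.replicate_succ, twos] using ih

@[simp] lemma length_ones (n : ℕ) : (ones n).length = n := by simp [ones]

lemma ones_succ (n : ℕ) : ones (n + 1) = Digit.one :: ones n := rfl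

lemma ones_succ' (n : ℕ) : ones (n + 1) = ones n ++ [Digit.one] := by
  simp [ones, List.replicate_succ']

lemma ones_add (m n : ℕ) : ones (m + n) = ones m ++ ones n := by
  exact List.replicate_add m n _

lemma ones_injective : Function.Injective ones := fun m n h => by
  simpa using congrArg List.length h

lemma exists_isLongestCommonSuffix (x y : YF) : ∃ s, IsLongestCommonSuffix s x y := by
  classical
  let p : ℕ → Prop := fun k => ∃ t : YF, t.length = k ∧ t <:+ x ∧ t <:+ y
  have h0 : p 0 := ⟨[], rfl, List.nil_suffix, List.nil_suffix⟩
  obtain ⟨s, hs, hx, hy⟩ := Nat.findGreatest_spec (P := p) (Nat.zero_le x.length) h0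
  exact ⟨s, hx, hy, fun t htx hty =>
    hs ▸ Nat.le_findGreatest htx.length_le ⟨t, rfl, htx, hty⟩⟩

/-- In the definition of the order any common suffix may serve in place of the longest one. -/
lemma le_iff {x y : YF} :
    le x y ↔ ∃ x' y' s : YF, x = x' ++ s ∧ y = y' ++ s ∧ x'.length ≤ twos y' := by
  constructor
  · rintro ⟨x', y', s, hx, hy, -, h⟩
    exact ⟨x', y', s, hx, hy, h⟩
  · rintro ⟨x', y', s, hx, hy, h⟩
    obtain ⟨t, ht⟩ := exists_isLongestCommonSuffix x y
    have hsx : s <:+ x := ⟨x', hx.symm⟩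
    obtain ⟨r, rfl⟩ := List.suffix_of_suffix_length_le hsx ht.1
      (ht.2.2 s hsx ⟨y', hy.symm⟩)
    obtain ⟨x'', hx''⟩ := ht.1
    obtain ⟨y'', hy''⟩ := ht.2.1
    refine ⟨x'', y'', r ++ s, hx''.symm, hy''.symm, ht, ?_⟩
    -- Moving r into the common suffix shortens the lower side by the length of r, while the upper
    -- side loses at most that many twos.
    have h1 : x' = x'' ++ r := by
      rw [← List.append_assoc, hx] at hx''
      exact (List.append_cancel_right hx'').symm
    have h2 : y' = y'' ++ r := by
      rw [← List.append_assoc, hy] at hy''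
      exact (List.append_cancel_right hy'').symm
    have := twos_le_length r
    simp only [h1, h2, List.length_append, twos_append] at h
    omega

lemma le_of_length_le_twos {x y : YF} (h : x.length ≤ twos y) : le x y :=
  le_iff.2 ⟨x, y, [], by simp, by simp, h⟩

lemma le_nil_left (y : YF) : le [] y := le_of_length_le_twos (Nat.zero_le _)

lemma le_nil_right {x : YF} : le x [] ↔ x = [] := by
  constructor
  · rintro ⟨x', y', s, hx, hy, -, h⟩
    obtain ⟨rfl, rfl⟩ : y' = [] ∧ s = [] := by simpa using hy.symm
    simpa [twos, hx] using h
  · rintro rfl; exact le_nil_left _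

lemma twos_singleton_le (a : Digit) : twos [a] ≤ 1 := by cases a <;> simp [twos]

lemma le_append_same {x y : YF} (a : Digit) : le (x ++ [a]) (y ++ [a]) ↔ le x y := by
  simp only [le_iff]
  constructor
  · rintro ⟨x', y', s, hx, hy, h⟩
    rcases List.eq_nil_or_concat s with rfl | ⟨s, b, rfl⟩
    · refine ⟨x, y, [], by simp, by simp, ?_⟩
      -- Dropping the last digit lowers the left side by one and the right side by at most one.
      have := twos_singleton_le a
      simp only [List.append_nil] at hx hy
      simp only [← hx, ← hy, List.length_append, twos_append, List.length_singleton] at h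
      omega
    · simp only [List.concat_eq_append, ← List.append_assoc] at hx hy
      exact ⟨x', y', s, (List.append_inj' hx rfl).1, (List.append_inj' hy rfl).1, h⟩
  · rintro ⟨x', y', s, rfl, rfl, h⟩
    exact ⟨x', y', s ++ [a], by simp, by simp, h⟩

lemma le_append_ne {x y : YF} {a b : Digit} (h : a ≠ b) :
    le (x ++ [a]) (y ++ [b]) ↔ x.length + 1 ≤ twos (y ++ [b]) := by
  constructor
  · rw [le_iff]
    rintro ⟨x', y', s, hx, hy, hl⟩
    rcases List.eq_nil_or_concat s with rfl | ⟨s, c, rfl⟩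
    · simp only [List.append_nil] at hx hy
      simpa [← hx, ← hy] using hl
    · simp only [List.concat_eq_append, ← List.append_assoc] at hx hy
      have h1 := (List.append_inj' hx rfl).2
      have h2 := (List.append_inj' hy rfl).2
      simp only [List.cons.injEq, and_true] at h1 h2
      exact absurd (h1.trans h2.symm) h
  · intro hl
    exact le_of_length_le_twos (by simpa using hl)

lemma le_append (s : YF) {x y : YF} : le (x ++ s) (y ++ s) ↔ le x y := by
  induction s using List.reverseRecOn with
  | nil => simp
  | append_singleton s a ih => rw [← List.append_assoc, ← List.append_assoc, le_append_same, ih]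

/-! ### Partial order axioms -/

lemma le_refl (x : YF) : le x x := le_iff.2 ⟨[], [], x, rfl, rfl, Nat.zero_le _⟩

lemma le_length {x y : YF} (h : le x y) : x.length ≤ y.length := by
  obtain ⟨x', y', s, rfl, rfl, h⟩ := le_iff.1 h
  have := twos_le_length y'
  simp only [List.length_append]; omega

lemma le_append_left (y s : YF) : le s (y ++ s) := le_iff.2 ⟨[], y, s, rfl, rfl, Nat.zero_le _⟩

/-- Outside a common suffix the inequalities between lengths and numbers of twos all become
equalities, so the parts that could differ are blocks of twos of equal length. -/
lemma le_antisymm {x y : YF} (h : le x y) (h' : le y x) : x = y := by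
  obtain ⟨x', y', s, rfl, rfl, h1⟩ := le_iff.1 h
  rw [le_append] at h'
  have h2 := le_length h'
  have h3 := twos_le_length y'
  have hy := eq_replicate_two_of_length_le (h2.trans h1)
  have h4 : x'.length = y'.length := by omega
  rw [le_append] at h
  obtain ⟨u, v, r, rfl, rfl, h5⟩ := le_iff.1 h'
  simp only [List.length_append] at h4
  have h6 := twos_le_length v
  have hv := eq_replicate_two_of_length_le (x := v) (by omega)
  have h7 : u = List.replicate u.length Digit.two := by
    rw [List.length_append, List.replicate_add] at hy
    exact (List.append_inj hy (by simp)).1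
  rw [h7, hv, show u.length = v.length by omega]

lemma le_trans {x y z : YF} (h : le x y) (h' : le y z) : le x z := by
  induction z using List.reverseRecOn generalizing x y with
  | nil => rw [le_nil_right.1 h'] at h; exact h
  | append_singleton z c ih =>
    rcases List.eq_nil_or_concat y with rfl | ⟨y, b, rfl⟩
    · rw [le_nil_right.1 h]; exact le_nil_left _
    rcases List.eq_nil_or_concat x with rfl | ⟨x, a, rfl⟩
    · exact le_nil_left _
    simp only [List.concat_eq_append] at *
    by_cases hbc : b = c
    · subst hbc
      rw [le_append_same] at h'
      by_cases hab : a = b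
      · subst hab
        rw [le_append_same] at h ⊢
        exact ih h h'
      · rw [le_append_ne hab, twos_append] at h ⊢
        obtain ⟨y', z', s, rfl, rfl, hl⟩ := le_iff.1 h'
        have := twos_le_length y'
        simp only [twos_append] at h ⊢
        omega
    · rw [le_append_ne hbc] at h'
      have := le_length h
      simp only [List.length_append, List.length_singleton] at this
      exact le_of_length_le_twos (by simp; omega)

lemma le_twos {x y : YF} (h : le x y) : twos x ≤ twos y := by
  obtain ⟨x', y', s, rfl, rfl, h⟩ := le_iff.1 h
  have := twos_le_length x'
  simp only [twos_append]; omega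

lemma ones_le_ones {m n : ℕ} : le (ones m) (ones n) ↔ m ≤ n := by
  constructor
  · intro h; simpa using le_length h
  · intro h
    obtain ⟨k, rfl⟩ := Nat.exists_eq_add_of_le' h
    rw [ones_add]; exact le_append_left _ _

/-! ### Prepending a digit -/

/-- A leading 1 contributes no two, so it can be dropped from the upper word unless nothing remains
outside the common suffix. -/
lemma le_one_cons {v x : YF} : le v (Digit.one :: x) ↔ v = Digit.one :: x ∨ le v x := by
  constructor
  · rw [le_iff]
    rintro ⟨v', y', s, rfl, hy, h⟩
    cases y' with
    | nil =>
      have : v' = [] := by simpa [twos] using h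
      left; simpa [this] using hy.symm
    | cons a y' =>
      obtain ⟨rfl, rfl⟩ := by simpa using hy
      exact .inr (le_iff.2 ⟨v', y', s, rfl, rfl, by simpa [twos] using h⟩)
  · rintro (rfl | h)
    · exact le_refl _
    · exact le_trans h (le_append_left [Digit.one] x)

/-- This is the covering of 1z by 2z. Both inequalities are tight, so outside the suffix the upper
word is a block of twos, and `x` can differ from it only in the first digit. -/
lemma eq_of_one_cons_le_of_le_two_cons {x z : YF} (h : le (Digit.one :: z) x)
    (h' : le x (Digit.two :: z)) : x = Digit.one :: z ∨ x = Digit.two :: z := by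
  obtain ⟨x', y', s, rfl, hy, hl⟩ := le_iff.1 h'
  cases y' with
  | nil =>
    have : x' = [] := by simpa [twos] using hl
    right; simpa [this] using hy.symm
  | cons a y' =>
    obtain ⟨rfl, rfl⟩ := by simpa using hy
    rw [← List.cons_append, le_append] at h
    have h1 := le_length h
    have h2 := twos_le_length y'
    simp only [twos, List.length_cons] at hl h1
    have hy := eq_replicate_two_of_length_le (x := y') (by omega)
    have hx : x'.length = y'.length + 1 := by omega
    generalize y'.length = n at *
    subst hy
    obtain ⟨u, v, r, hu, rfl, h3⟩ := le_iff.1 h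
    have h4 := congrArg List.length hu
    simp only [List.length_cons, List.length_append, List.length_replicate] at h4 hx
    have h5 := twos_le_length v
    have hv := eq_replicate_two_of_length_le (x := v) (by omega)
    cases u with
    | nil =>
      have : v = [] := List.eq_nil_of_length_eq_zero (by simp at h4; omega)
      left; simpa [this] using congrArg (· ++ s) hu.symm
    | cons a u =>
      simp only [List.cons_append, List.cons.injEq] at hu
      right
      have : r = List.replicate r.length Digit.two := by
        have h6 : r <:+ List.replicate n Digit.two := ⟨u, hu.2.symm⟩
        exact List.eq_replicate_of_mem fun b hb => List.eq_of_mem_replicate (h6.subset hb)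
      rw [hv, this, List.replicate_append_replicate, show v.length + r.length = n + 1 by omega]
      rfl

/-- If part of 1x lies outside the common suffix, only its length matters and its first digit is
free. Otherwise 1x is a suffix of z; its 1 is moved out of the suffix and paid for by the leading 2.
-/
lemma one_cons_le_two_cons {x z : YF} :
    le (Digit.one :: x) (Digit.two :: z) ↔ le (Digit.two :: x) (Digit.two :: z) := by
  constructor
  · rw [le_iff]
    rintro ⟨x', y', s, hx, hy, h⟩
    cases x' with
    | nil =>
      cases y' with
      | nil => simp at hx hy; rw [← hy] at hx; simp at hx
      | cons a y' =>
        obtain ⟨rfl, rfl⟩ := by simpa using hy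
        obtain rfl : Digit.one :: x = s := by simpa using hx
        exact le_iff.2 ⟨[Digit.two], Digit.two :: (y' ++ [Digit.one]), x, rfl, by simp, by
          simp [twos]⟩
    | cons a x' =>
      obtain ⟨rfl, rfl⟩ := by simpa using hx
      exact le_iff.2 ⟨Digit.two :: x', y', s, rfl, hy, by simpa using h⟩
  · exact le_trans (le_append (x := [Digit.one]) (y := [Digit.two]) x |>.2
      (le_of_length_le_twos (by simp [twos])))

/-- The ideal condition alone has one spurious solution, x = 1 and y = 2; the constant of the
language serves to exclude it. -/
lemma eq_one_cons_iff {x y : YF} :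
    y = Digit.one :: x ↔ y ≠ [Digit.two] ∧ x ≠ y ∧ ∀ v, le v y ↔ v = y ∨ le v x := by
  constructor
  · rintro rfl
    exact ⟨by simp, by simp, fun v => le_one_cons⟩
  · rintro ⟨h2, hne, h⟩
    have hxy : le x y := (h x).2 (.inr (le_refl x))
    cases y with
    | nil => exact absurd (le_nil_right.1 hxy) hne
    | cons a z =>
      cases a with
      | one =>
        have hx := (le_one_cons.1 hxy).resolve_left hne
        have hz := ((h z).1 (le_append_left [Digit.one] z)).resolve_left (by simp)
        rw [le_antisymm hx hz]
      | two =>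
        exfalso
        have h1 : le (Digit.one :: z) x := ((h _).1 (one_cons_le_two_cons.2 (le_refl _))).resolve_left
          (by simp)
        obtain rfl := (eq_of_one_cons_le_of_le_two_cons h1 hxy).resolve_right hne
        -- For nonempty `z`, the word 2z has below it a word other than itself that is not below 1z:
        -- 2z' if z = 1z', and 21z' if z = 2z'.
        cases z with
        | nil => exact h2 rfl
        | cons b z =>
          cases b with
          | one =>
            have h3 := ((h (Digit.two :: z)).1 (le_iff.2 ⟨[Digit.two], [Digit.two, Digit.one], z,
              rfl, rfl, by simp [twos]⟩)).resolve_left (by simp)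
            simp only [le_one_cons, List.cons.injEq, reduceCtorEq, false_and, false_or] at h3
            simpa using le_length h3
          | two =>
            have h3 := ((h (Digit.two :: Digit.one :: z)).1 (le_iff.2 ⟨[Digit.two, Digit.one],
              [Digit.two, Digit.two], z, rfl, rfl, by simp [twos]⟩)).resolve_left (by simp)
            simp only [le_one_cons, List.cons.injEq, reduceCtorEq, false_and, false_or] at h3
            simpa using le_length h3

/-- By `one_cons_le_two_cons`, 2x is the least word beginning with 2 that lies above 1x. -/
lemma eq_two_cons_iff {x y : YF} :
    y = Digit.two :: x ↔ (∃ z, y = Digit.two :: z) ∧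
      ∀ v, (∃ z, v = Digit.two :: z) → (le (Digit.one :: x) v ↔ le y v) := by
  constructor
  · rintro rfl
    refine ⟨⟨x, rfl⟩, ?_⟩
    rintro _ ⟨z, rfl⟩
    exact one_cons_le_two_cons
  · rintro ⟨⟨z, rfl⟩, h⟩
    exact le_antisymm ((h _ ⟨x, rfl⟩).1 (one_cons_le_two_cons.2 (le_refl _)))
      (one_cons_le_two_cons.1 ((h _ ⟨z, rfl⟩).2 (le_refl _)))

/-- The interval from s to 1^n s is the chain of the words 1^k s. Conversely the condition passes
from 1z to z, so leading ones can be stripped until `s` is reached. -/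
lemma exists_eq_ones_append_iff {s z : YF} :
    (∃ n, z = ones n ++ s) ↔
      le s z ∧ ∀ v, le s v → le v z → v = s ∨ ∃ u, v = Digit.one :: u := by
  constructor
  · rintro ⟨n, rfl⟩
    refine ⟨le_append_left _ _, fun v hs hv => ?_⟩
    induction n with
    | zero => exact .inl (le_antisymm hv hs)
    | succ n ih =>
      rw [ones_succ, List.cons_append, le_one_cons] at hv
      rcases hv with rfl | hv
      · exact .inr ⟨_, rfl⟩
      · exact ih hv
  · rintro ⟨hs, h⟩
    induction z with
    | nil => exact ⟨0, (le_nil_right.1 hs).symm⟩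
    | cons a z ih =>
      rcases h _ hs (le_refl _) with rfl | ⟨u, hu⟩
      · exact ⟨0, rfl⟩
      · obtain ⟨rfl, rfl⟩ := by simpa using hu
        rcases le_one_cons.1 hs with rfl | hs'
        · exact ⟨0, rfl⟩
        obtain ⟨n, rfl⟩ := ih hs' fun v h1 h2 => h v h1 (le_one_cons.2 (.inr h2))
        exact ⟨n + 1, rfl⟩

/-! ### Comparing lengths -/

lemma le_append_one_two {x y : YF} :
    le (x ++ [Digit.one]) (y ++ [Digit.two]) ↔ x.length ≤ twos y := by
  rw [le_append_ne (by simp), twos_append]; simp [twos]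

lemma le_append_two_one {x y : YF} :
    le (x ++ [Digit.two]) (y ++ [Digit.one]) ↔ x.length + 1 ≤ twos y := by
  rw [le_append_ne (by simp), twos_append]; simp [twos]

lemma ones_le_append_two {n : ℕ} {y : YF} :
    le (ones n) (y ++ [Digit.two]) ↔ n ≤ twos y + 1 := by
  cases n with
  | zero => simpa [ones] using le_nil_left _
  | succ n => rw [ones_succ', le_append_one_two]; simp

lemma ones_le_of_le_twos {n : ℕ} {y : YF} (h : n ≤ twos y) : le (ones n) y :=
  le_of_length_le_twos (by simpa using h)

/-- The words `1ᵇ⁺¹` and `1ᵇ2` of equal length are recognized by words ending in `1ʲ22`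
with large `j`. -/
lemma eq_succ_iff_exists_le {a b : ℕ} (ha : a ≠ 1 ∨ b ≠ 0) :
    a = b + 1 ↔ ∀ j, ∃ w, le (ones j ++ [Digit.two, Digit.two]) w ∧ le (ones a) w ∧
      ¬ le (ones (a + 1)) w ∧ le (ones b ++ [Digit.two]) w ∧
      ¬ le (ones (b + 1) ++ [Digit.two]) w := by
  constructor
  · rintro rfl j
    -- A word ending in 22 is above 11, so no witness exists for the pair 1, 2; hence that pair is
    -- excluded.
    obtain ⟨b, rfl⟩ : ∃ c, b = c + 1 := Nat.exists_eq_succ_of_ne_zero (by omega)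
    refine ⟨List.replicate b Digit.two ++ (ones j ++ [Digit.two, Digit.two]),
      le_append_left _ _, ?_⟩
    rw [show List.replicate b Digit.two ++ (ones j ++ [Digit.two, Digit.two]) =
      (List.replicate b Digit.two ++ ones j ++ [Digit.two]) ++ [Digit.two] by simp]
    simp only [ones_le_append_two, le_append_same, twos_append, twos_replicate_two, twos_ones,
      twos]
    omega
  · intro h
    -- With j = a+1 the bound twos w ≤ a rules out the endings 1 and 12. So w = w'22, and the
    -- maximal exponents of 1^a and 1^b 2 below `w` are twos w' + 2 and twos w' + 1.
    obtain ⟨w, hj, ha1, ha2, hb1, hb2⟩ := h (a + 1)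
    have hw : twos w ≤ a := by
      by_contra hlt
      exact ha2 (ones_le_of_le_twos (by omega))
    rw [show ones (a + 1) ++ [Digit.two, Digit.two] = (ones (a + 1) ++ [Digit.two]) ++ [Digit.two]
      by simp] at hj
    rcases List.eq_nil_or_concat w with rfl | ⟨w, c, rfl⟩
    · simp [le_nil_right] at hj
    simp only [List.concat_eq_append] at *
    cases c with
    | one =>
      rw [le_append_two_one] at hj
      simp [twos_append, twos] at hj hw
      omega
    | two =>
      rw [le_append_same] at hj hb1 hb2
      rcases List.eq_nil_or_concat w with rfl | ⟨w, c, rfl⟩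
      · simp [le_nil_right] at hj
      simp only [List.concat_eq_append] at *
      cases c with
      | one =>
        rw [le_append_two_one] at hj
        simp [twos_append, twos] at hj hw
        omega
      | two =>
        simp only [ones_le_append_two, twos_append, twos] at *
        omega

/-- Whichever digit ends `w`, the test word ending in the other digit forces the count of twos. -/
lemma succ_le_twos_iff {n : ℕ} {w : YF} :
    n + 1 ≤ twos w ↔ le (ones (n + 1)) w ∧ le (ones n ++ [Digit.two]) w := by
  rcases List.eq_nil_or_concat w with rfl | ⟨w, c, rfl⟩
  · simp [le_nil_right, twos]
  simp only [List.concat_eq_append]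
  cases c with
  | one =>
    rw [ones_succ', le_append_same, le_append_two_one]
    simp only [twos_append, twos, length_ones]
    exact ⟨fun h => ⟨ones_le_of_le_twos (by omega), by omega⟩, fun h => by omega⟩
  | two =>
    rw [ones_le_append_two, le_append_same]
    simp only [twos_append, twos]
    exact ⟨fun h => ⟨by omega, ones_le_of_le_twos (by omega)⟩, fun h => by omega⟩

lemma le_replicate_two {x : YF} {n : ℕ} :
    le x (List.replicate n Digit.two) ↔ x.length ≤ n :=
  ⟨fun h => by simpa using le_length h, fun h => le_of_length_le_twos (by simpa using h)⟩

lemma length_le_iff_forall_le {x : YF} {n : ℕ} :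
    x.length ≤ n ↔ ∀ v, n ≤ twos v → le x v :=
  ⟨fun h _ hv => le_of_length_le_twos (h.trans hv), fun h => le_replicate_two.1 (h _ (by simp))⟩

lemma replicate_two_le {n : ℕ} {v : YF} :
    le (List.replicate n Digit.two) v ↔ n ≤ twos v :=
  ⟨fun h => by simpa using le_twos h, fun h => le_of_length_le_twos (by simpa using h)⟩

/-- The word `2ⁿ⁺¹u` is the join of `1ⁿ⁺¹u` and `1ⁿ2u`. -/
lemma replicate_two_append_le {n : ℕ} {u v : YF} :
    le (List.replicate (n + 1) Digit.two ++ u) v ↔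
      le (ones (n + 1) ++ u) v ∧ le (ones n ++ Digit.two :: u) v := by
  induction u using List.reverseRecOn generalizing v with
  | nil => rw [List.append_nil, List.append_nil, replicate_two_le, succ_le_twos_iff]
  | append_singleton u a ih =>
    rw [← List.append_assoc, ← List.append_assoc, ← List.cons_append, ← List.append_assoc]
    rcases List.eq_nil_or_concat v with rfl | ⟨v, c, rfl⟩
    · simp [le_nil_right]
    simp only [List.concat_eq_append]
    by_cases hac : a = c
    · subst hac
      simp only [le_append_same, ih]
    · simp only [le_append_ne hac, List.length_append, List.length_replicate, length_ones,
        List.length_cons]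
      omega

lemma eq_replicate_two_append_iff {n : ℕ} {u y : YF} :
    y = List.replicate (n + 1) Digit.two ++ u ↔
      ∀ v, le y v ↔ le (ones (n + 1) ++ u) v ∧ le (ones n ++ Digit.two :: u) v := by
  simp only [← replicate_two_append_le]
  constructor
  · rintro rfl v; rfl
  · intro h
    exact le_antisymm ((h _).2 (le_refl _)) ((h _).1 (le_refl _))

/-! ### Leading ones and the staircase -/

lemma leadingOnes_ones_append (n : ℕ) (u : YF) :
    leadingOnes (ones n ++ u) = n + leadingOnes u := by
  induction n with
  | zero => simp [ones]
  | succ n ih => rw [ones_succ, List.cons_append, leadingOnes, ih]; omega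

lemma exists_eq_ones_append (v : YF) :
    ∃ u, v = ones (leadingOnes v) ++ u ∧ leadingOnes u = 0 := by
  induction v with
  | nil => exact ⟨[], rfl, rfl⟩
  | cons a v ih =>
    cases a with
    | one =>
      obtain ⟨u, hu, h0⟩ := ih
      refine ⟨u, ?_, h0⟩
      rw [leadingOnes, ones_succ, List.cons_append, ← hu]
    | two => exact ⟨Digit.two :: v, rfl, rfl⟩

lemma leadingOnes_eq_zero_iff {u : YF} : leadingOnes u = 0 ↔ ¬ ∃ z, u = Digit.one :: z := by
  cases u with
  | nil => simp [leadingOnes]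
  | cons a u => cases a <;> simp [leadingOnes]

lemma leadingOnes_append_le (x s : YF) : leadingOnes (x ++ s) ≤ x.length + leadingOnes s := by
  induction x with
  | nil => simp
  | cons a x ih => cases a <;> (simp [leadingOnes]; try omega)

/-- A word below xs can replace x by at most twos x digits in front of s, and taking all of them to
be ones attains the bound. -/
lemma forall_le_leadingOnes_le_iff {n : ℕ} {w : YF} :
    (∀ v, le v w → leadingOnes v ≤ n) ↔
      ∀ x s, w = x ++ s → twos x + leadingOnes s ≤ n := by
  constructor
  · rintro h x s rfl
    rw [← leadingOnes_ones_append]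
    exact h _ ((le_append s).2 (ones_le_of_le_twos le_rfl))
  · intro h v hv
    obtain ⟨v', w', s, rfl, rfl, hl⟩ := le_iff.1 hv
    have := leadingOnes_append_le v' s
    have := h w' s rfl
    omega

lemma staircase_zero (n : ℕ) : staircase n 0 = ones n := by simp [staircase]

lemma staircase_succ (n m : ℕ) :
    staircase (n + 1) (m + 1) = ones (n + 1) ++ Digit.two :: staircase n m := by
  simp [staircase, List.range_succ_eq_map, List.flatMap_map]

/-- Doubled and rearranged so that neither division nor truncated subtraction occurs. -/
lemma length_staircase {n m : ℕ} (h : m ≤ n) :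
    2 * (staircase n m).length + m ^ 2 = 2 * n + 2 * (m * n) + m := by
  induction m generalizing n with
  | zero => simp [staircase_zero]
  | succ m ih =>
    obtain ⟨n, rfl⟩ : ∃ k, n = k + 1 := Nat.exists_eq_succ_of_ne_zero (by omega)
    have := ih (n := n) (by omega)
    simp only [staircase_succ, List.length_append, length_ones, List.length_cons]
    nlinarith

lemma twos_staircase {n m : ℕ} (h : m ≤ n) : twos (staircase n m) = m := by
  induction m generalizing n with
  | zero => simp [staircase_zero]
  | succ m ih =>
    obtain ⟨n, rfl⟩ : ∃ k, n = k + 1 := Nat.exists_eq_succ_of_ne_zero (by omega)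
    simp [staircase_succ, twos_append, twos, ih (n := n) (by omega)]

/-- Passing a block of ones followed by a digit `2` costs one unit of the bound. -/
lemma forall_suffix_ones_append_two_iff {a n : ℕ} {w : YF} :
    (∀ x s, ones a ++ Digit.two :: w = x ++ s → twos x + leadingOnes s ≤ n + 1) ↔
      a ≤ n + 1 ∧ ∀ x s, w = x ++ s → twos x + leadingOnes s ≤ n := by
  constructor
  · intro h
    refine ⟨?_, ?_⟩
    · simpa [twos, leadingOnes_ones_append, leadingOnes] using h [] _ rfl
    · rintro x s rfl
      have := h (ones a ++ Digit.two :: x) s (by simp)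
      simp only [twos_append, twos_ones, twos] at this
      omega
  · rintro ⟨ha, h⟩ x s hxs
    induction a generalizing x with
    | zero =>
      cases x with
      | nil =>
        obtain rfl : _ = s := hxs
        simp [ones, twos, leadingOnes]
      | cons b x =>
        obtain ⟨rfl, hxs'⟩ := by simpa [ones] using hxs
        have := h x s hxs'
        simp only [twos]; omega
    | succ a ih =>
      cases x with
      | nil =>
        obtain rfl : _ = s := hxs
        rw [leadingOnes_ones_append]
        simpa [twos, leadingOnes] using ha
      | cons b x =>
        obtain ⟨rfl, hxs'⟩ := by simpa [ones_succ] using hxs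
        exact ih (by omega) x hxs'

lemma suffix_bound_ones {n : ℕ} (x s : YF) (h : ones n = x ++ s) :
    twos x + leadingOnes s ≤ n := by
  have h1 := congrArg twos h
  have h2 := congrArg List.length h
  have h3 := leadingOnes_append_le s []
  simp [twos_append, leadingOnes] at h1 h2 h3
  omega

lemma staircase_mem_boundedWords {n m : ℕ} (h : m ≤ n) : staircase n m ∈ boundedWords n m := by
  refine ⟨(twos_staircase h).le, forall_le_leadingOnes_le_iff.2 ?_⟩
  induction m generalizing n with
  | zero => rw [staircase_zero]; exact suffix_bound_ones
  | succ m ih =>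
    obtain ⟨n, rfl⟩ : ∃ k, n = k + 1 := Nat.exists_eq_succ_of_ne_zero (by omega)
    rw [staircase_succ, forall_suffix_ones_append_two_iff]
    exact ⟨le_rfl, ih (by omega)⟩

/-- Writing w = 1^a 2 u, the bound gives a ≤ n+1 and leaves for `u` the same problem with `n` and
`m` in place of n+1 and m+1. Equal length therefore forces a full first block and, inductively, the
staircase. -/
lemma length_lt_length_staircase {n m : ℕ} (h : m ≤ n) {w : YF} (hw : w ∈ boundedWords n m)
    (hne : w ≠ staircase n m) : w.length < (staircase n m).length := by
  obtain ⟨h2, hb⟩ := hw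
  rw [forall_le_leadingOnes_le_iff] at hb
  induction m generalizing n w with
  | zero =>
    obtain ⟨u, hu, h0⟩ := exists_eq_ones_append w
    cases u with
    | nil =>
      have := hb [] w rfl
      rw [List.append_nil] at hu
      have hl : w.length = leadingOnes w := by simpa using congrArg List.length hu
      rw [staircase_zero] at hne ⊢
      have : leadingOnes w ≠ n := fun hn => hne (hn ▸ hu)
      simp [twos] at *
      omega
    | cons a u =>
      cases a with
      | one => simp [leadingOnes] at h0
      | two => rw [hu] at h2; simp [twos_append, twos] at h2
  | succ m ih =>
    obtain ⟨n, rfl⟩ : ∃ k, n = k + 1 := Nat.exists_eq_succ_of_ne_zero (by omega)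
    obtain ⟨u, hu, h0⟩ := exists_eq_ones_append w
    have hlead := hb [] w rfl
    simp only [twos, zero_add] at hlead
    rw [staircase_succ] at hne ⊢
    simp only [List.length_append, length_ones, List.length_cons]
    generalize leadingOnes w = a at *
    subst hu
    cases u with
    | nil => simp; omega
    | cons b u =>
      cases b with
      | one => simp [leadingOnes] at h0
      | two =>
        rw [forall_suffix_ones_append_two_iff] at hb
        simp only [twos_append, twos_ones, twos] at h2
        by_cases hus : u = staircase n m
        · subst hus
          have : a ≠ n + 1 := by rintro rfl; exact hne rfl
          simp; omega
        · have := ih (n := n) (by omega) hus (by omega) hb.2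
          simp; omega

/-! ### Definable predicates -/

/-- The predicate `P` on assignments is definable in `YF*` without parameters. -/
def IsDefinable {α : Type} (P : (α → YF) → Prop) : Prop :=
  (∅ : Set YF).Definable starLanguage {v | P v}

namespace IsDefinable

variable {α : Type} {P Q : (α → YF) → Prop}

lemma congr (hP : IsDefinable P) (h : ∀ v, Q v ↔ P v) : IsDefinable Q := by
  rwa [show Q = P from funext fun v => propext (h v)]

lemma and (hP : IsDefinable P) (hQ : IsDefinable Q) : IsDefinable fun v => P v ∧ Q v :=
  Set.Definable.inter hP hQ

lemma or (hP : IsDefinable P) (hQ : IsDefinable Q) : IsDefinable fun v => P v ∨ Q v :=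
  Set.Definable.union hP hQ

lemma not (hP : IsDefinable P) : IsDefinable fun v => ¬ P v :=
  Set.Definable.compl hP

lemma imp (hP : IsDefinable P) (hQ : IsDefinable Q) : IsDefinable fun v => P v → Q v :=
  (hP.not.or hQ).congr fun _ => imp_iff_not_or

lemma iff (hP : IsDefinable P) (hQ : IsDefinable Q) : IsDefinable fun v => P v ↔ Q v :=
  ((hP.imp hQ).and (hQ.imp hP)).congr fun _ => iff_iff_implies_and_implies

/-- Bound variables are handled by extending the index type: `none` is the quantified word and `some
a` the old variable. -/
lemma ex {R : (α → YF) → YF → Prop}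
    (h : IsDefinable fun v : Option α → YF => R (fun a => v (some a)) (v none)) :
    IsDefinable fun v => ∃ x, R v x := by
  obtain ⟨φ, hφ⟩ := Set.empty_definable_iff.1 h
  refine Set.empty_definable_iff.2
    ⟨(φ.relabel (fun o : Option α => o.elim (Sum.inr ()) Sum.inl)).iExs Unit, ?_⟩
  ext v
  simp only [Set.mem_ofPred_eq, Formula.realize_iExs, Formula.realize_relabel]
  have key : ∀ w : Option α → YF, φ.Realize w ↔ R (fun a => w (some a)) (w none) := fun w =>
    (Set.ext_iff.1 hφ w).symm
  constructor
  · rintro ⟨x, hx⟩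
    exact ⟨fun _ => x, (key _).2 hx⟩
  · rintro ⟨i, hi⟩
    exact ⟨i (), (key _).1 hi⟩

lemma all {R : (α → YF) → YF → Prop}
    (h : IsDefinable fun v : Option α → YF => R (fun a => v (some a)) (v none)) :
    IsDefinable fun v => ∀ x, R v x :=
  (ex (R := fun v x => ¬ R v x) h.not).not.congr fun _ => not_exists_not.symm

/-! ### Definability of the order, the digits and single words -/

lemma le (i j : α) : IsDefinable fun v => le (v i) (v j) := by
  refine Set.empty_definable_iff.2 ⟨Relations.formula₂ (L := starLanguage) StarRelations.ge
    (Term.var j) (Term.var i), ?_⟩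
  ext v
  simp only [Set.mem_ofPred_eq]
  rfl

lemma eq (i j : α) : IsDefinable fun v => v i = v j :=
  ((le i j).and (le j i)).congr fun _ =>
    ⟨fun h => h ▸ ⟨le_refl _, le_refl _⟩, fun h => le_antisymm h.1 h.2⟩

lemma eq_two (i : α) : IsDefinable fun v => v i = [Digit.two] := by
  refine Set.empty_definable_iff.2 ⟨Term.equal (L := starLanguage) (Term.var i)
    (Constants.term (L := starLanguage) StarFunctions.two), ?_⟩
  ext v
  simp only [Set.mem_ofPred_eq, Formula.realize_equal]
  rfl

lemma eq_nil (i : α) : IsDefinable fun v => v i = [] :=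
  (all (R := fun v x => YoungFibonacci.le (v i) x) (le _ _)).congr fun _ =>
    ⟨fun h x => h ▸ le_nil_left x, fun h => le_nil_right.1 (h [])⟩

lemma eq_one_cons (i j : α) : IsDefinable fun v => v i = Digit.one :: v j :=
  ((eq_two i).not.and ((eq j i).not.and (all ((le none (some i)).iff
    ((eq none (some i)).or (le none (some j))))))).congr fun _ => eq_one_cons_iff

lemma exists_eq_one_cons (i : α) : IsDefinable fun v => ∃ z, v i = Digit.one :: z :=
  ex (eq_one_cons (some i) none)

lemma exists_eq_two_cons (i : α) : IsDefinable fun v => ∃ z, v i = Digit.two :: z :=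
  ((eq_nil i).not.and (exists_eq_one_cons i).not).congr fun v => by
    rcases v i with _ | ⟨_ | _, _⟩ <;> simp

lemma eq_two_cons (i j : α) : IsDefinable fun v => v i = Digit.two :: v j := by
  refine ((exists_eq_two_cons i).and (ex (R := fun v x => x = Digit.one :: v j ∧
    ∀ y, (∃ z, y = Digit.two :: z) → (YoungFibonacci.le x y ↔ YoungFibonacci.le (v i) y))
    ((eq_one_cons none (some j)).and (all ((exists_eq_two_cons none).imp
      ((le (some none) none).iff (le (some (some i)) none))))))).congr fun v => ?_
  rw [eq_two_cons_iff]
  simp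

lemma eq_const (u : YF) (i : α) : IsDefinable fun v => v i = u := by
  induction u generalizing α with
  | nil => exact eq_nil i
  | cons a u ih =>
    cases a with
    | one =>
      exact congr (P := fun v => ∃ x, x = u ∧ v i = Digit.one :: x)
        (ex ((ih none).and (eq_one_cons (some i) none))) fun v => by simp
    | two =>
      exact congr (P := fun v => ∃ x, x = u ∧ v i = Digit.two :: x)
        (ex ((ih none).and (eq_two_cons (some i) none))) fun v => by simp

lemma exists_eq_ones_append (i j : α) : IsDefinable fun v => ∃ n, v i = ones n ++ v j :=
  ((le j i).and (all ((le (some j) none).imp ((le none (some i)).imp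
    ((eq none (some j)).or (exists_eq_one_cons none)))))).congr
      fun _ => exists_eq_ones_append_iff

lemma exists_eq_ones_append_const (i : α) (s : YF) :
    IsDefinable fun v => ∃ n, v i = ones n ++ s :=
  congr (P := fun v => ∃ x, x = s ∧ ∃ n, v i = ones n ++ x)
    (ex ((eq_const s none).and (exists_eq_ones_append (some i) none))) fun v => by simp

lemma exists_eq_ones (i : α) : IsDefinable fun v => ∃ n, v i = ones n :=
  (exists_eq_ones_append_const i []).congr fun v => by simp

/-- The condition that recognizes words `1ᵇ⁺¹` and `1ᵇ2`. -/
lemma eq_ones_succ_and_eq (i j : α) :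
    IsDefinable fun v => ∃ n, v i = ones (n + 1) ∧ v j = ones n ++ [Digit.two] := by
  -- The pair 1, 2 is a separate disjunct because `eq_succ_iff_exists_le` does not cover it.
  refine (((eq_const [Digit.one] i).and (eq_const [Digit.two] j)).or
    ((exists_eq_ones i).and ((exists_eq_ones_append_const j [Digit.two]).and
      (((eq_const [Digit.one] i).not.or (eq_const [Digit.two] j).not).and
        (all (R := fun v u => (∃ n, u = ones n ++ [Digit.two, Digit.two]) →
          ∃ w, YoungFibonacci.le u w ∧ YoungFibonacci.le (v i) w ∧
            (¬ ∃ x, x = Digit.one :: v i ∧ YoungFibonacci.le x w) ∧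
            YoungFibonacci.le (v j) w ∧
            ¬ ∃ x, x = Digit.one :: v j ∧ YoungFibonacci.le x w)
          ((exists_eq_ones_append_const none _).imp (ex
            ((le (some none) none).and ((le _ none).and
              ((ex ((eq_one_cons none _).and (le none (some none)))).not.and
                ((le _ none).and
                  (ex ((eq_one_cons none _).and (le none (some none)))).not)))))))
        )))).congr fun v => ?_
  constructor
  · rintro ⟨n, h1, h2⟩
    rw [h1, h2]
    by_cases hn : n = 0
    · left; subst hn; exact ⟨rfl, rfl⟩
    · refine .inr ⟨⟨_, rfl⟩, ⟨_, rfl⟩, .inl fun h => hn ?_, ?_⟩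
      · simpa using congrArg List.length h
      · rintro _ ⟨j, rfl⟩
        simpa [ones_succ] using (eq_succ_iff_exists_le (a := n + 1) (b := n) (.inr hn)).1 rfl j
  · rintro (⟨h1, h2⟩ | ⟨⟨a, ha⟩, ⟨b, hb⟩, hne, h⟩)
    · exact ⟨0, h1, h2⟩
    · rw [ha, hb] at hne h ⊢
      have h' : a ≠ 1 ∨ b ≠ 0 := by
        refine hne.imp (fun h e => h ?_) (fun h e => h ?_) <;> subst e <;> rfl
      obtain rfl : a = b + 1 := (eq_succ_iff_exists_le h').2 fun j => by
        simpa [ones_succ] using h _ ⟨j, rfl⟩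
      exact ⟨b, rfl, rfl⟩

/-! ### Definability of the number of twos and of length -/

lemma exists_eq_ones_and_le_twos (i j : α) :
    IsDefinable fun v => ∃ n, v i = ones n ∧ n ≤ twos (v j) := by
  refine congr (P := fun v => v i = [] ∨ ∃ z, (∃ n, v i = ones (n + 1) ∧
      z = ones n ++ [Digit.two]) ∧ YoungFibonacci.le (v i) (v j) ∧ YoungFibonacci.le z (v j))
    ((eq_nil i).or (ex ((eq_ones_succ_and_eq _ none).and ((le (some i) (some j)).and
      (le none _))))) fun v => ?_
  constructor
  · rintro ⟨_ | n, h1, h2⟩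
    · exact .inl h1
    · have := succ_le_twos_iff.1 h2
      exact .inr ⟨_, ⟨n, h1, rfl⟩, h1 ▸ this.1, this.2⟩
  · rintro (h | ⟨_, ⟨n, h1, rfl⟩, h2, h3⟩)
    · exact ⟨0, h, Nat.zero_le _⟩
    · exact ⟨n + 1, h1, succ_le_twos_iff.2 ⟨h1 ▸ h2, h3⟩⟩

/-- A function to the natural numbers, encoded by words of ones, is definable as soon as its
hypograph is. -/
lemma eq_ones_of_le {f : (α → YF) → ℕ} {i : α}
    (h : IsDefinable fun v : Option α → YF =>
      ∃ n, v none = ones n ∧ n ≤ f fun a => v (some a)) :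
    IsDefinable fun v => v i = ones (f v) := by
  refine congr (P := fun v => (∃ n, v i = ones n) ∧
    ∀ x, (∃ n, x = ones n ∧ n ≤ f v) ↔ (∃ n, x = ones n) ∧ YoungFibonacci.le x (v i))
    ((exists_eq_ones i).and (all (h.iff ((exists_eq_ones none).and (le none (some i))))))
    fun v => ?_
  constructor
  · intro hv
    refine ⟨⟨_, hv⟩, fun x => ⟨?_, ?_⟩⟩
    · rintro ⟨n, rfl, hn⟩; exact ⟨⟨n, rfl⟩, hv ▸ ones_le_ones.2 hn⟩
    · rintro ⟨⟨n, rfl⟩, hn⟩; exact ⟨n, rfl, ones_le_ones.1 (hv ▸ hn)⟩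
  · rintro ⟨⟨k, hk⟩, hx⟩
    simp only [hk] at hx ⊢
    obtain ⟨n, h1, h2⟩ := (hx _).2 ⟨⟨k, rfl⟩, le_refl _⟩
    obtain rfl := ones_injective h1
    rw [h2.antisymm (ones_le_ones.1 ((hx _).1 ⟨_, rfl, le_rfl⟩).2)]

lemma eq_ones_twos (i j : α) : IsDefinable fun v => v i = ones (twos (v j)) :=
  eq_ones_of_le (exists_eq_ones_and_le_twos none (some j))

lemma length_le (i j : α) : IsDefinable fun v => ∃ n, v i = ones n ∧ (v j).length ≤ n := by
  refine congr (P := fun v => (∃ n, v i = ones n) ∧ ∀ x, (∃ n, v i = ones n ∧ n ≤ twos x) →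
      YoungFibonacci.le (v j) x)
    ((exists_eq_ones i).and (all ((exists_eq_ones_and_le_twos (some i) none).imp
      (le (some j) none)))) fun v => ?_
  constructor
  · rintro ⟨n, h1, h2⟩
    refine ⟨⟨n, h1⟩, ?_⟩
    rintro x ⟨k, h3, h4⟩
    obtain rfl := ones_injective (h1.symm.trans h3)
    exact length_le_iff_forall_le.1 h2 x h4
  · rintro ⟨⟨n, h1⟩, h⟩
    exact ⟨n, h1, length_le_iff_forall_le.2 fun x hx => h x ⟨n, h1, hx⟩⟩

lemma eq_ones_length (i j : α) : IsDefinable fun v => v i = ones (v j).length := by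
  refine congr (P := fun v => (∃ n, v i = ones n ∧ (v j).length ≤ n) ∧
      ∀ x, (∃ n, x = ones n ∧ (v j).length ≤ n) → YoungFibonacci.le (v i) x)
    ((length_le i j).and (all ((length_le none (some j)).imp (le (some i) none)))) fun v => ?_
  constructor
  · intro h
    refine ⟨⟨_, h, le_rfl⟩, ?_⟩
    rintro _ ⟨n, rfl, hn⟩
    rw [h]; exact ones_le_ones.2 hn
  · rintro ⟨⟨n, h1, h2⟩, h⟩
    have h3 := h _ ⟨_, rfl, le_rfl⟩
    rw [h1, ones_le_ones] at h3
    rw [h1, h2.antisymm h3]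

lemma length_eq (i j : α) : IsDefinable fun v => (v i).length = (v j).length :=
  congr (P := fun v => ∃ x, x = ones (v i).length ∧ x = ones (v j).length)
    (ex ((eq_ones_length none _).and (eq_ones_length none _))) fun v => by
      simp [ones_injective.eq_iff]

lemma length_le_length (i j : α) : IsDefinable fun v => (v i).length ≤ (v j).length :=
  congr (P := fun v => ∃ x, x = ones (v j).length ∧ ∃ n, x = ones n ∧ (v i).length ≤ n)
    (ex ((eq_ones_length none _).and (length_le none _))) fun v => by
      simp [ones_injective.eq_iff]

/-- For positive exponent the word is a join of some 1^n s and 1^m 2s; requiring equal lengths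
forces n = m+1. -/
lemma exists_eq_replicate_two_append (i j : α) :
    IsDefinable fun v => ∃ m, v i = List.replicate m Digit.two ++ v j := by
  refine congr (P := fun v => v i = v j ∨ ∃ x y, (∃ n, x = ones n ++ v j) ∧
      (∃ u, u = Digit.two :: v j ∧ ∃ n, y = ones n ++ u) ∧ x.length = y.length ∧
      ∀ z, YoungFibonacci.le (v i) z ↔ YoungFibonacci.le x z ∧ YoungFibonacci.le y z)
    ((eq i j).or (ex (ex ((exists_eq_ones_append (some none) (some (some j))).and
      ((ex ((eq_two_cons none (some (some (some j)))).and
        (exists_eq_ones_append (some none) none))).and ((length_eq (some none) none).and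
          (all ((le (some (some (some i))) none).iff
            ((le (some (some none)) none).and (le (some none) none)))))))))) fun v => ?_
  constructor
  · rintro ⟨_ | m, hm⟩
    · exact .inl hm
    · exact .inr ⟨_, _, ⟨m + 1, rfl⟩, ⟨_, rfl, m, rfl⟩, by simp; omega,
        eq_replicate_two_append_iff.1 hm⟩
  · rintro (h | ⟨_, _, ⟨n, rfl⟩, ⟨_, rfl, m, rfl⟩, hl, h⟩)
    · exact ⟨0, h⟩
    · obtain rfl : n = m + 1 := by simp at hl; omega
      exact ⟨m + 1, eq_replicate_two_append_iff.2 h⟩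

/-- The graph of addition. -/
lemma eq_ones_add (i j k : α) :
    IsDefinable fun v => ∃ m l, v i = ones (m + l) ∧ v j = ones m ∧ v k = ones l := by
  -- The auxiliary word is w = 2^m 1^l, which has m twos and length m+l.
  refine congr (P := fun v => (∃ l, v k = ones l) ∧
      ∃ w, (∃ m, w = List.replicate m Digit.two ++ v k) ∧ v i = ones w.length ∧
        v j = ones (twos w))
    ((exists_eq_ones k).and (ex ((exists_eq_replicate_two_append none (some k)).and
      ((eq_ones_length (some i) none).and (eq_ones_twos (some j) none))))) fun v => ?_
  constructor
  · rintro ⟨m, l, hi, hj, hk⟩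
    exact ⟨⟨l, hk⟩, _, ⟨m, rfl⟩, by simp [hi, hk], by simp [hj, hk, twos_append]⟩
  · rintro ⟨⟨l, hk⟩, _, ⟨m, rfl⟩, hi, hj⟩
    exact ⟨m, l, by simpa [hk] using hi, by simpa [hk, twos_append] using hj, hk⟩

/-- Strip all leading ones to get u; addition recovers their number as the difference of the two
lengths. -/
lemma eq_ones_leadingOnes (i j : α) : IsDefinable fun v => v i = ones (leadingOnes (v j)) := by
  refine congr (P := fun v => ∃ u, (¬ ∃ z, u = Digit.one :: z) ∧ (∃ n, v j = ones n ++ u) ∧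
      ∃ x, x = ones (v j).length ∧ ∃ y, y = ones u.length ∧
        ∃ m l, x = ones (m + l) ∧ v i = ones m ∧ y = ones l)
    (ex ((exists_eq_one_cons none).not.and ((exists_eq_ones_append (some j) none).and
      (ex ((eq_ones_length none (some (some j))).and (ex
        ((eq_ones_length none (some (some none))).and
          (eq_ones_add (some none) (some (some (some i))) none)))))))) fun v => ?_
  simp only [← leadingOnes_eq_zero_iff]
  constructor
  · intro hi
    obtain ⟨u, hu, h0⟩ := YoungFibonacci.exists_eq_ones_append (v j)
    refine ⟨u, h0, ⟨_, hu⟩, _, rfl, _, rfl, _, _, ?_, hi, rfl⟩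
    simpa using congrArg (fun w : YF => ones w.length) hu
  · rintro ⟨u, h0, ⟨n, hn⟩, _, rfl, _, rfl, m, l, h1, h2, h3⟩
    have h4 := ones_injective h1
    have h5 := ones_injective h3
    simp only [hn, List.length_append, length_ones] at h4
    rw [h2, hn, leadingOnes_ones_append, h0, show n + 0 = m by omega]

lemma mem_boundedWords (i j k : α) :
    IsDefinable fun v => ∃ n m, v i = ones n ∧ v j = ones m ∧ v k ∈ boundedWords n m := by
  refine congr (P := fun v => (∃ n, v i = ones n) ∧ (∃ m, v j = ones m) ∧
      (∃ x, x = ones (twos (v k)) ∧ YoungFibonacci.le x (v j)) ∧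
      ∀ u, YoungFibonacci.le u (v k) →
        ∃ x, x = ones (leadingOnes u) ∧ YoungFibonacci.le x (v i))
    ((exists_eq_ones i).and ((exists_eq_ones j).and
      ((ex ((eq_ones_twos none (some k)).and (le none (some j)))).and
        (all ((le none (some k)).imp (ex ((eq_ones_leadingOnes none (some none)).and
          (le none (some (some i)))))))))) fun v => ?_
  constructor
  · rintro ⟨n, m, h1, h2, h3, h4⟩
    simp only [h1, h2, exists_eq_left, ones_le_ones]
    exact ⟨⟨_, rfl⟩, ⟨_, rfl⟩, h3, h4⟩
  · rintro ⟨⟨n, h1⟩, ⟨m, h2⟩, h⟩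
    simp only [h1, h2, exists_eq_left, ones_le_ones] at h
    exact ⟨n, m, h1, h2, h⟩

/-- The staircase is the longest word in `boundedWords n m`. -/
lemma eq_staircase (i j k : α) :
    IsDefinable fun v => ∃ n m, m ≤ n ∧ v i = ones n ∧ v j = ones m ∧ v k = staircase n m := by
  refine congr (P := fun v => YoungFibonacci.le (v j) (v i) ∧
      (∃ n m, v i = ones n ∧ v j = ones m ∧ v k ∈ boundedWords n m) ∧
      ∀ w, (∃ n m, v i = ones n ∧ v j = ones m ∧ w ∈ boundedWords n m) →
        w.length ≤ (v k).length)
    ((le j i).and ((mem_boundedWords i j k).and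
      (all ((mem_boundedWords (some i) (some j) none).imp
        (length_le_length none (some k)))))) fun v => ?_
  constructor
  · rintro ⟨n, m, h, h1, h2, h3⟩
    rw [h1, h2, h3]
    refine ⟨ones_le_ones.2 h, ⟨n, m, rfl, rfl, staircase_mem_boundedWords h⟩, ?_⟩
    rintro w ⟨n', m', h4, h5, hw⟩
    obtain rfl := ones_injective h4
    obtain rfl := ones_injective h5
    by_cases hne : w = staircase n m
    · rw [hne]
    · exact (length_lt_length_staircase h hw hne).le
  · rintro ⟨h, ⟨n, m, h1, h2, h3⟩, h4⟩
    rw [h1, h2, ones_le_ones] at h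
    refine ⟨n, m, h, h1, h2, ?_⟩
    by_contra hne
    have h5 := length_lt_length_staircase h h3 hne
    have h6 := h4 _ ⟨n, m, h1, h2, staircase_mem_boundedWords h⟩
    omega

lemma eq_ones_length_staircase (i j : α) :
    IsDefinable fun v => ∃ n, v i = ones n ∧ v j = ones (staircase n n).length := by
  refine congr (P := fun v => ∃ w,
      (∃ n m, m ≤ n ∧ v i = ones n ∧ v i = ones m ∧ w = staircase n m) ∧ v j = ones w.length)
    (ex ((eq_staircase (some i) (some i) none).and (eq_ones_length (some j) none))) fun v => ?_
  constructor
  · rintro ⟨n, h1, h2⟩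
    exact ⟨_, ⟨n, n, le_rfl, h1, h1, rfl⟩, h2⟩
  · rintro ⟨_, ⟨n, m, -, h1, h2, rfl⟩, h3⟩
    obtain rfl := ones_injective (h1.symm.trans h2)
    exact ⟨n, h1, h3⟩

/-- The graph of multiplication. -/
lemma eq_ones_mul (i j k : α) :
    IsDefinable fun v => ∃ n m, v i = ones n ∧ v j = ones m ∧ v k = ones (n * m) := by
  refine congr (P := fun v => ∃ s, (∃ n m, s = ones (n + m) ∧ v i = ones n ∧ v j = ones m) ∧
      ∃ a, (∃ n, v i = ones n ∧ a = ones (staircase n n).length) ∧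
      ∃ b, (∃ n, v j = ones n ∧ b = ones (staircase n n).length) ∧
      ∃ c, (∃ n, s = ones n ∧ c = ones (staircase n n).length) ∧
      ∃ d, (∃ x y, d = ones (x + y) ∧ a = ones x ∧ b = ones y) ∧
        ∃ x y, c = ones (x + y) ∧ d = ones x ∧ v k = ones y)
    (ex ((eq_ones_add none (some i) (some j)).and
      (ex ((eq_ones_length_staircase (some (some i)) none).and
      (ex ((eq_ones_length_staircase (some (some (some j))) none).and
      (ex ((eq_ones_length_staircase (some (some (some none))) none).and
      (ex ((eq_ones_add none (some (some (some none))) (some (some none))).and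
        (eq_ones_add (some none) none (some (some (some (some (some k)))))))))))))))) fun v => ?_
  -- Polarization of L(n) = (n²+3n)/2: the linear terms cancel and the cross term is exactly nm.
  have key : ∀ n m : ℕ, (staircase (n + m) (n + m)).length =
      (staircase n n).length + (staircase m m).length + n * m := fun n m => by
    have h1 := length_staircase (n := n) le_rfl
    have h2 := length_staircase (n := m) le_rfl
    have h3 := length_staircase (n := (n + m)) le_rfl
    nlinarith
  constructor
  · rintro ⟨n, m, h1, h2, h3⟩
    exact ⟨_, ⟨n, m, rfl, h1, h2⟩, _, ⟨n, h1, rfl⟩, _, ⟨m, h2, rfl⟩, _, ⟨_, rfl, rfl⟩, _,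
      ⟨_, _, rfl, rfl, rfl⟩, _, _, congrArg ones (key n m), rfl, h3⟩
  · rintro ⟨s, ⟨n, m, hs, h1, h2⟩, a, ⟨n', h1', ha⟩, b, ⟨m', h2', hb⟩, c, ⟨p, hp, hc⟩, d,
      ⟨x, y, hd, hx, hy⟩, x', y', hc', hd', h3⟩
    obtain rfl := ones_injective (h1.symm.trans h1')
    obtain rfl := ones_injective (h2.symm.trans h2')
    obtain rfl := ones_injective (hs.symm.trans hp)
    have e1 := ones_injective (ha.symm.trans hx)
    have e2 := ones_injective (hb.symm.trans hy)
    have e3 := ones_injective (hc.symm.trans hc')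
    have e4 := ones_injective (hd.symm.trans hd')
    have := key n m
    exact ⟨n, m, h1, h2, by rw [h3, show y' = n * m by omega]⟩

end IsDefinable

/-! ### Interpretation of arithmetic and the main theorem -/

lemma eq_vecCons_three_iff {p : Fin 3 → YF} {a b c : YF} :
    p = ![a, b, c] ↔ p 0 = a ∧ p 1 = b ∧ p 2 = c := by
  constructor
  · rintro rfl; exact ⟨rfl, rfl, rfl⟩
  · rintro ⟨rfl, rfl, rfl⟩
    ext i : 1
    fin_cases i <;> rfl

/-- The map `n ↦ 1ⁿ` interprets arithmetic. -/
lemma isInterpretation_ones : IsInterpretation arithLanguage starLanguage ones where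
  injective := ones_injective
  range_definable := (IsDefinable.exists_eq_ones (0 : Fin 1)).congr fun v => by
    simp [eq_comm]
  rel_definable _ R := R.elim
  fun_definable
    | _, ArithFunctions.add => by
      -- `Fin.snoc` puts the value last, so the sum is coordinate 2.
      refine (IsDefinable.eq_ones_add (2 : Fin 3) 0 1).congr fun v => ?_
      constructor
      · rintro ⟨a, rfl⟩
        exact ⟨a 0, a 1, rfl, rfl, rfl⟩
      · rintro ⟨m, l, h2, h0, h1⟩
        refine ⟨![m, l], funext fun i => ?_⟩
        fin_cases i
        exacts [h0, h1, h2]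
    | _, ArithFunctions.mul => by
      refine (IsDefinable.eq_ones_mul (0 : Fin 3) 1 2).congr fun v => ?_
      constructor
      · rintro ⟨a, rfl⟩
        exact ⟨a 0, a 1, rfl, rfl, rfl⟩
      · rintro ⟨m, l, h0, h1, h2⟩
        refine ⟨![m, l], funext fun i => ?_⟩
        fin_cases i
        exacts [h0, h1, h2]

end YoungFibonacci

theorem mainTheorem5 :
    -- the graph of addition
    (∅ : Set YoungFibonacci.YF).Definable YoungFibonacci.starLanguage
      {p : Fin 3 → YoungFibonacci.YF | ∃ n m l : ℕ,
        p = ![YoungFibonacci.ones n, YoungFibonacci.ones m, YoungFibonacci.ones l] ∧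
          n = m + l} ∧
    -- the graph of multiplication
    (∅ : Set YoungFibonacci.YF).Definable YoungFibonacci.starLanguage
      {p : Fin 3 → YoungFibonacci.YF | ∃ n m l : ℕ,
        p = ![YoungFibonacci.ones n, YoungFibonacci.ones m, YoungFibonacci.ones l] ∧
          n * m = l} ∧
    -- the longest vertex with bounded number of 2's and bounded prefixes of 1's
    (∀ n m : ℕ, m ≤ n →
      YoungFibonacci.staircase n m ∈ YoungFibonacci.boundedWords n m ∧
      (∀ w ∈ YoungFibonacci.boundedWords n m, w ≠ YoungFibonacci.staircase n m →
        w.length < (YoungFibonacci.staircase n m).length) ∧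
      ((YoungFibonacci.staircase n m).length : ℚ) =
        (n : ℚ) + (m : ℚ) * (n : ℚ) - ((m : ℚ) ^ 2 - (m : ℚ)) / 2) ∧
    (∅ : Set YoungFibonacci.YF).Definable YoungFibonacci.starLanguage
      {p : Fin 3 → YoungFibonacci.YF | ∃ n m : ℕ, m ≤ n ∧
        p = ![YoungFibonacci.ones n, YoungFibonacci.ones m, YoungFibonacci.staircase n m]} ∧
    -- every vertex is definable, and `n ↦ 1ⁿ` interprets arithmetic
    (∀ u : YoungFibonacci.YF,
      (∅ : Set YoungFibonacci.YF).Definable₁ YoungFibonacci.starLanguage {u}) ∧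
    YoungFibonacci.IsInterpretation YoungFibonacci.arithLanguage YoungFibonacci.starLanguage
      YoungFibonacci.ones := by
  refine ⟨?_, ?_, fun n m h => ⟨YoungFibonacci.staircase_mem_boundedWords h,
    fun w => YoungFibonacci.length_lt_length_staircase h, ?_⟩, ?_,
    fun u => YoungFibonacci.IsDefinable.eq_const u (0 : Fin 1),
    YoungFibonacci.isInterpretation_ones⟩
  · refine (YoungFibonacci.IsDefinable.eq_ones_add (0 : Fin 3) 1 2).congr fun p => ?_
    simp only [YoungFibonacci.eq_vecCons_three_iff]
    constructor
    · rintro ⟨_, m, l, h, rfl⟩; exact ⟨m, l, h⟩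
    · rintro ⟨m, l, h⟩; exact ⟨_, m, l, h, rfl⟩
  · refine (YoungFibonacci.IsDefinable.eq_ones_mul (0 : Fin 3) 1 2).congr fun p => ?_
    simp only [YoungFibonacci.eq_vecCons_three_iff]
    constructor
    · rintro ⟨n, m, _, h, rfl⟩; exact ⟨n, m, h⟩
    · rintro ⟨n, m, h⟩; exact ⟨n, m, _, h, rfl⟩
  · have h' := congrArg (Nat.cast : ℕ → ℚ) (YoungFibonacci.length_staircase h)
    push_cast at h'
    linarith
  · refine (YoungFibonacci.IsDefinable.eq_staircase (0 : Fin 3) 1 2).congr fun p => ?_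
    simp only [YoungFibonacci.eq_vecCons_three_iff]
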